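/- Let $d\ge 0$ be an integer and let $G$ be a countable (finite or infinite, not necessarily connected) simple graph all of whose vertices have degree at most $d$. For $S\subseteq V(G)$ let $G[S]$ be the subgraph induced on $S$; the size of a component is its number of vertices. A set $Y\subseteq V(G)$ is a $k$-separator of $G$ if all components of $G[V(G)\setminus Y]$ have size at most $k$. Then the following five properties of $G$ are equivalent. 1. (Property A) For every $\varepsilon>0$ there are an integer $r>1$ and probability measures $\Theta(x)$ on $V(G)$, one for each $x\in V(G)$, such that the support of each $\Theta(x)$ is contained in the ball of radius $r$ around $x$ in $G$, and $\|\Theta(x)-\Theta(y)\|_1<\varepsilon$ for all adjacent vertices $x,y$. 2. (Uniform local amenability) For every $\varepsilon>0$ there is an integer $k>0$ such that every non-empty finite set $L\subseteq V(G)$ has a non-empty subset $M\subseteq L$ with $|M|\le k$ and $|\partial_L M|/|M|<\varepsilon$, where $\partial_L M$ is the set of vertices of $M$ that are adjacent to a vertex of $L\setminus M$. 3. (Local hyperfiniteness) For every $\varepsilon>0$ there is an integer $k>0$ such that every non-empty finite set $L\subseteq V(G)$ has a subset $L'\subseteq L$ with $|L'|<\varepsilon|L|$ such that all components of $G[L\setminus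 L']$ have size at most $k$. 4. (Weighted hyperfiniteness) For every $\varepsilon>0$ there is an integer $k>0$ such that for every finitely supported function $w:V(G)\to[0,\infty)$ there is a $k$-separator $L$ of $G$ with $\sum_{v\in L}w(v)\le\varepsilon\sum_{v\in V(G)}w(v)$. 5. (Strong hyperfiniteness) For every $\varepsilon>0$ there are an integer $k>0$ and a Borel probability measure $\mu$ on the space of $k$-separators of $G$ (with the topology induced from the product space $\{0,1\}^{V(G)}$) such that $\mu(\{Y : x\in Y\})<\varepsilon$ for every $x\in V(G)$. -/

import Mathlib

open MeasureTheory

namespace BoundedDegreeGraph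

universe u

variable {V : Type u}

/-- Every vertex of `G` has at most `d` neighbours. -/
def HasDegreeBound (G : SimpleGraph V) (d : ℕ) : Prop :=
  ∀ v : V, (G.neighborSet v).encard ≤ d

/-- The closed ball of radius `r` around `x`. The extended distance is infinite between
different connected components. -/
def ball (G : SimpleGraph V) (x : V) (r : ℕ) : Set V :=
  {y | G.edist x y ≤ r}

/-- All connected components of the subgraph of `G` induced on `S` have at most `k` vertices. -/
def ComponentsLE (G : SimpleGraph V) (S : Set V) (k : ℕ) : Prop :=
  ∀ C : (G.induce S).ConnectedComponent, C.supp.encard ≤ k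

/-- `p` is (the mass function of) a probability measure on the vertex set. -/
def IsProb (p : V → ℝ) : Prop :=
  (∀ v, 0 ≤ p v) ∧ HasSum p 1

/-- Property A. -/
def PropertyA (G : SimpleGraph V) : Prop :=
  ∀ ε : ℝ, 0 < ε → ∃ r : ℕ, 1 < r ∧ ∃ Θ : V → V → ℝ,
    (∀ x, IsProb (Θ x)) ∧
    (∀ x, Function.support (Θ x) ⊆ ball G x r) ∧
    (∀ x y, G.Adj x y → ∑' v, |Θ x v - Θ y v| < ε)

/-- The boundary of `M` relative to `L`: the vertices of `M` having a neighbour in `L`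
outside `M`. -/
def relBoundary (G : SimpleGraph V) (L M : Set V) : Set V :=
  {x | x ∈ M ∧ ∃ y ∈ L, y ∉ M ∧ G.Adj x y}

/-- `M` is an `ε`-Følner set of the subgraph of `G` induced on `L`. -/
def IsFolnerIn (G : SimpleGraph V) (ε : ℝ) (L M : Set V) : Prop :=
  M ⊆ L ∧ M.Finite ∧ M.Nonempty ∧
    ((relBoundary G L M).ncard : ℝ) / (M.ncard : ℝ) < ε

/-- Uniform local amenability. -/
def UniformlyLocallyAmenable (G : SimpleGraph V) : Prop :=
  ∀ ε : ℝ, 0 < ε → ∃ k : ℕ, 0 < k ∧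
    ∀ L : Set V, L.Finite → L.Nonempty →
      ∃ M : Set V, IsFolnerIn G ε L M ∧ M.ncard ≤ k

/-- Local hyperfiniteness. -/
def LocallyHyperfinite (G : SimpleGraph V) : Prop :=
  ∀ ε : ℝ, 0 < ε → ∃ k : ℕ, 0 < k ∧
    ∀ L : Set V, L.Finite → L.Nonempty →
      ∃ L' : Set V, L' ⊆ L ∧ (L'.ncard : ℝ) < ε * (L.ncard : ℝ) ∧
        ComponentsLE G (L \ L') k

/-- `Y` is a `k`-separator of `G`: deleting `Y` leaves components of at most `k` vertices. -/
def IsSeparator (G : SimpleGraph V) (k : ℕ) (Y : Set V) : Prop :=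
  ComponentsLE G Yᶜ k

/-- Weighted hyperfiniteness. The sums have finitely many nonzero terms. -/
def WeightedHyperfinite (G : SimpleGraph V) : Prop :=
  ∀ ε : ℝ, 0 < ε → ∃ k : ℕ, 0 < k ∧
    ∀ w : V → ℝ, (∀ v, 0 ≤ w v) → (Function.support w).Finite →
      ∃ L : Set V, ∑ᶠ v ∈ L, w v ≤ ε * ∑ᶠ v, w v ∧ IsSeparator G k L

/-- The space of `k`-separators, a set of vertices being given by its characteristic function
in the product space `V → Bool`. As a subtype it carries the subspace topology of the product
topology and, for countable `V`, the corresponding Borel σ-algebra. -/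
def Separators (G : SimpleGraph V) (k : ℕ) : Set (V → Bool) :=
  {Y | IsSeparator G k {v | Y v = true}}

/-- Strong hyperfiniteness: there is a random `k`-separator containing each vertex with
probability less than `ε`. -/
def StronglyHyperfinite (G : SimpleGraph V) : Prop :=
  ∀ ε : ℝ, 0 < ε → ∃ k : ℕ, 0 < k ∧
    ∃ μ : Measure (Separators G k), IsProbabilityMeasure μ ∧
      ∀ x : V, μ {Y | Y.1 x = true} < ENNReal.ofReal ε

end BoundedDegreeGraph

/-! The properties are linked in a cycle 1 → 2 → 3 → 4 → 5 → 1.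

From 1 to 2: for fixed `v` the positive level sets of `x ↦ Θ x v` lie in a ball around `v`, so their
size is bounded. If none were Følner in `L`, the coarea inequality `sum_le_variation_of_level_sets`,
summed over `v`, would force a total ℓ¹ variation of at least `ε|L|` along the at most `d|L|`
oriented edges of `L`, more than property A allows.

From 2 to 3: Følner sets are split off greedily, and only their relative boundaries are deleted.

From 3 to 4: vertices are sorted by the logarithm of their weight. Deleting those with a far heavier
neighbour, and one sparse periodic family of levels, leaves mutually non-adjacent bands of
comparable weights. On a band, few vertices means little weight.

From 4 to 5: the `k`-separators form a compact space, and 4 answers every finite weighting of the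
vertices by a single separator. Minimax (`exists_isProbabilityMeasure_integral_nonpos`) turns this
into one random separator that is good at all vertices.

From 5 to 1: `Θ x` is the expected uniform distribution on the component of `x` off the random
separator. Adjacent vertices share a component unless one of them is deleted. -/

namespace BoundedDegreeGraph

variable {V : Type*} {G : SimpleGraph V}

/-! ### Clusters, component sizes and balls -/

section Clusters

/-- The spanning subgraph of `G` whose edges are those of `G` with both ends in `S`. -/
def edgesInside (G : SimpleGraph V) (S : Set V) : SimpleGraph V where
  Adj a b := a ∈ S ∧ b ∈ S ∧ G.Adj a b
  symm := ⟨fun _ _ h => ⟨h.2.1, h.1, h.2.2.symm⟩⟩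
  loopless := ⟨fun a h => G.loopless.irrefl a h.2.2⟩

/-- The vertices joined to `x` by a path of `G` inside `S`; this is `{x}` if `x ∉ S`. -/
def cluster (G : SimpleGraph V) (S : Set V) (x : V) : Set V :=
  {y | (edgesInside G S).Reachable x y}

variable {S T : Set V} {x y : V} {k : ℕ}

lemma edgesInside_mono (h : S ⊆ T) : edgesInside G S ≤ edgesInside G T :=
  fun _ _ hab => ⟨h hab.1, h hab.2.1, hab.2.2⟩

lemma edgesInside_le : edgesInside G S ≤ G := fun _ _ h => h.2.2

lemma mem_cluster_self (G : SimpleGraph V) (S : Set V) (x : V) : x ∈ cluster G S x :=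
  SimpleGraph.Reachable.refl x

lemma cluster_mono (h : S ⊆ T) : cluster G S x ⊆ cluster G T x :=
  fun _ hy => SimpleGraph.Reachable.mono (edgesInside_mono h) hy

lemma cluster_eq_of_mem (h : y ∈ cluster G S x) : cluster G S y = cluster G S x := by
  ext z
  exact ⟨fun hz => SimpleGraph.Reachable.trans h hz,
    fun hz => SimpleGraph.Reachable.trans (SimpleGraph.Reachable.symm h) hz⟩

lemma cluster_eq_of_adj (hx : x ∈ S) (hy : y ∈ S) (h : G.Adj x y) :
    cluster G S x = cluster G S y :=
  (cluster_eq_of_mem (SimpleGraph.Adj.reachable (G := edgesInside G S) ⟨hx, hy, h⟩)).symm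

/-- A property that holds at `x` and spreads along edges inside `S` holds on the cluster. -/
lemma cluster_induction {P : V → Prop} (hx : P x)
    (h : ∀ a b, a ∈ S → b ∈ S → G.Adj a b → P a → P b) (hy : y ∈ cluster G S x) : P y := by
  have hy' := (SimpleGraph.reachable_iff_reflTransGen _ _).1 hy
  induction hy' with
  | refl => exact hx
  | tail hab hbc ih =>
    exact h _ _ hbc.1 hbc.2.1 hbc.2.2 (ih ((SimpleGraph.reachable_iff_reflTransGen _ _).2 hab))

lemma cluster_subset_of_mem (hx : x ∈ S) : cluster G S x ⊆ S :=
  fun _ hy => cluster_induction (P := (· ∈ S)) hx (fun _ _ _ hb _ _ => hb) hy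

lemma cluster_of_notMem (hx : x ∉ S) : cluster G S x = {x} := by
  refine Set.Subset.antisymm (fun y hy => ?_) (by simpa using mem_cluster_self G S x)
  refine cluster_induction (P := (· = x)) rfl (fun a b ha _ _ hax => ?_) hy
  exact absurd (hax ▸ ha) hx

/-- If `f` is constant along the edges inside `S`, clusters lie inside clusters of the fibres. -/
lemma cluster_subset_cluster_fibre {ι : Type*} (f : V → ι)
    (hf : ∀ a b, a ∈ S → b ∈ S → G.Adj a b → f a = f b) (x : V) :
    cluster G S x ⊆ cluster G {v | v ∈ S ∧ f v = f x} x := by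
  intro y hy
  refine (cluster_induction
    (P := fun y => f y = f x ∧ y ∈ cluster G {v | v ∈ S ∧ f v = f x} x) ⟨rfl, mem_cluster_self _ _ _⟩
    (fun a b ha hb hab hP => ?_) hy).2
  have hbx : f b = f x := (hf a b ha hb hab).symm.trans hP.1
  exact ⟨hbx, SimpleGraph.Reachable.trans hP.2
    (SimpleGraph.Adj.reachable (G := edgesInside G _) ⟨⟨ha, hP.1⟩, ⟨hb, hbx⟩, hab⟩)⟩

lemma induce_reachable_iff (a b : S) :
    (G.induce S).Reachable a b ↔ (b : V) ∈ cluster G S a := by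
  constructor
  · intro h
    have h' := (SimpleGraph.reachable_iff_reflTransGen _ _).1 h
    refine (SimpleGraph.reachable_iff_reflTransGen _ _).2
      (Relation.ReflTransGen.lift (p := (edgesInside G S).Adj) Subtype.val
        (fun c d hcd => ⟨c.2, d.2, ?_⟩) _ _ h')
    simpa using hcd
  · intro h
    obtain ⟨hb, hr⟩ := cluster_induction (S := S) (G := G) (x := (a : V))
      (P := fun y => ∃ hy : y ∈ S, (G.induce S).Reachable a ⟨y, hy⟩) ⟨a.2, SimpleGraph.Reachable.refl _⟩
      (fun c d _ hd hcd hP => by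
        obtain ⟨hc, hr⟩ := hP
        refine ⟨hd, hr.trans (SimpleGraph.Adj.reachable ?_)⟩
        simpa using hcd) h
    exact hr

/-- Clusters are sets in `V` itself, so bounds for different `S` can be compared without moving
between subtypes. -/
lemma componentsLE_iff : ComponentsLE G S k ↔ ∀ x ∈ S, (cluster G S x).encard ≤ k := by
  have key : ∀ a : S, Subtype.val '' ((G.induce S).connectedComponentMk a).supp
      = cluster G S (a : V) := by
    intro a
    ext y
    constructor
    · rintro ⟨b, hb, rfl⟩
      have : (G.induce S).Reachable b a := SimpleGraph.ConnectedComponent.exact hb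
      exact (induce_reachable_iff a b).1 this.symm
    · intro hy
      have hyS := cluster_subset_of_mem a.2 hy
      refine ⟨⟨y, hyS⟩, ?_, rfl⟩
      exact SimpleGraph.ConnectedComponent.sound ((induce_reachable_iff a ⟨y, hyS⟩).2 hy).symm
  constructor
  · intro h x hx
    rw [← key ⟨x, hx⟩, Subtype.val_injective.encard_image]
    exact h _
  · intro h C
    induction C using SimpleGraph.ConnectedComponent.ind with
    | h a =>
      rw [← Subtype.val_injective.encard_image, key a]
      exact h a a.2

/-- Positivity of `k` pays for the singleton clusters of vertices outside `S`. -/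
lemma ComponentsLE.cluster_encard_le (h : ComponentsLE G S k) (hk : 0 < k) (x : V) :
    (cluster G S x).encard ≤ k := by
  by_cases hx : x ∈ S
  · exact componentsLE_iff.1 h x hx
  · rw [cluster_of_notMem hx, Set.encard_singleton]
    exact_mod_cast hk

lemma ComponentsLE.mono (h : ComponentsLE G T k) (hST : S ⊆ T) : ComponentsLE G S k :=
  componentsLE_iff.2 fun x hx =>
    (Set.encard_le_encard (cluster_mono hST)).trans (componentsLE_iff.1 h x (hST hx))

/-- If `f` is constant along the edges inside `S` and every fibre of `f` in `S` has small
components, so does `S`. -/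
lemma componentsLE_of_fibres {ι : Type*} (f : V → ι)
    (hf : ∀ a b, a ∈ S → b ∈ S → G.Adj a b → f a = f b)
    (h : ∀ x ∈ S, ComponentsLE G {v | v ∈ S ∧ f v = f x} k) : ComponentsLE G S k :=
  componentsLE_iff.2 fun x hx =>
    (Set.encard_le_encard (cluster_subset_cluster_fibre f hf x)).trans
      (componentsLE_iff.1 (h x hx) x ⟨hx, rfl⟩)

lemma componentsLE_of_encard_le (h : S.encard ≤ k) : ComponentsLE G S k :=
  componentsLE_iff.2 fun _ hx => (Set.encard_le_encard (cluster_subset_of_mem hx)).trans h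

/-- A path inside `S` uses only finitely many vertices. -/
lemma exists_finset_mem_cluster (h : y ∈ cluster G S x) :
    ∃ F : Finset V, (F : Set V) ⊆ S ∧ y ∈ cluster G F x := by
  classical
  refine cluster_induction (P := fun y => ∃ F : Finset V, (F : Set V) ⊆ S ∧ y ∈ cluster G F x)
    ⟨∅, by simp, mem_cluster_self _ _ _⟩ (fun a b ha hb hab hP => ?_) h
  obtain ⟨F, hFS, hF⟩ := hP
  refine ⟨insert a (insert b F), ?_, ?_⟩
  · intro v hv
    simp only [Finset.coe_insert, Set.mem_insert_iff, Finset.mem_coe] at hv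
    rcases hv with rfl | rfl | hv
    exacts [ha, hb, hFS hv]
  · refine SimpleGraph.Reachable.trans (cluster_mono (by intro v hv; simp [Finset.mem_coe.1 hv]) hF)
      (SimpleGraph.Adj.reachable (G := edgesInside G _) ⟨by simp, by simp, hab⟩)

/-- A path inside the cluster has distinct vertices, hence at most `k` of them. -/
lemma edist_le_of_mem_cluster (hk : (cluster G S x).encard ≤ k) (hy : y ∈ cluster G S x) :
    G.edist x y ≤ k := by
  classical
  obtain ⟨p, hp⟩ := SimpleGraph.Reachable.exists_isPath hy
  have hsub : (p.support.toFinset : Set V) ⊆ cluster G S x := by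
    intro v hv
    exact ⟨p.takeUntil v (by simpa using hv)⟩
  have hcard : p.length + 1 = p.support.toFinset.card := by
    rw [List.toFinset_card_of_nodup hp.support_nodup, SimpleGraph.Walk.length_support]
  have h1 : ((p.length + 1 : ℕ) : ℕ∞) ≤ k := by
    rw [hcard, ← Set.encard_coe_eq_coe_finsetCard]
    exact (Set.encard_le_encard hsub).trans hk
  calc G.edist x y ≤ (edgesInside G S).edist x y := SimpleGraph.edist_anti edgesInside_le
    _ ≤ p.length := SimpleGraph.edist_le p
    _ ≤ k := le_trans (by exact_mod_cast Nat.le_succ _) h1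

lemma mem_ball_comm {r : ℕ} : y ∈ ball G x r ↔ x ∈ ball G y r := by
  simp only [ball, Set.mem_ofPred_eq, SimpleGraph.edist_comm]

lemma ball_encard_le {d : ℕ} (hd : HasDegreeBound G d) (x : V) (r : ℕ) :
    (ball G x r).encard ≤ ((d + 1) ^ r : ℕ) := by
  induction r with
  | zero =>
    have : ball G x 0 = {x} := by
      ext y
      simp [ball, eq_comm (a := y)]
    simp [this]
  | succ r ih =>
    have hfin : (ball G x r).Finite :=
      Set.finite_of_encard_le_coe ih
    have hsub : ball G x (r + 1) ⊆ ⋃ z ∈ hfin.toFinset, insert z (G.neighborSet z) := by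
      intro y hy
      -- The walk is taken from `y` to `x`: its first edge leads to a neighbour of `y` within
      -- distance `r` of `x`.
      have hne : G.edist y x ≠ ⊤ := by
        rw [SimpleGraph.edist_comm]
        exact ne_top_of_le_ne_top (ENat.natCast_ne_top (r + 1)) hy
      obtain ⟨p, hp⟩ := SimpleGraph.exists_walk_of_edist_ne_top hne
      have hlen : p.length ≤ r + 1 := by
        have : G.edist x y ≤ ((r + 1 : ℕ) : ℕ∞) := hy
        rw [SimpleGraph.edist_comm, ← hp] at this
        exact_mod_cast this
      simp only [Set.mem_iUnion, Set.Finite.mem_toFinset, exists_prop]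
      cases p with
      | nil => exact ⟨x, by simp [ball], by simp⟩
      | cons h q =>
        refine ⟨_, ?_, Set.mem_insert_of_mem _ h.symm⟩
        show G.edist _ _ ≤ _
        rw [SimpleGraph.edist_comm]
        refine (SimpleGraph.edist_le q).trans ?_
        simp only [SimpleGraph.Walk.length_cons] at hlen
        exact_mod_cast (by omega : q.length ≤ r)
    have hcard : (hfin.toFinset.card : ℕ∞) ≤ ((d + 1) ^ r : ℕ) := by
      rw [← hfin.encard_eq_coe_toFinset_card]; exact ih
    calc (ball G x (r + 1)).encard
        ≤ (⋃ z ∈ hfin.toFinset, insert z (G.neighborSet z)).encard := Set.encard_le_encard hsub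
      _ ≤ ∑ z ∈ hfin.toFinset, (insert z (G.neighborSet z)).encard := by
          generalize hfin.toFinset = F
          classical
          induction F using Finset.induction_on with
          | empty => simp
          | insert a F ha ih' =>
            rw [Finset.set_biUnion_insert, Finset.sum_insert ha]
            exact (Set.encard_union_le _ _).trans (add_le_add le_rfl ih')
      _ ≤ ∑ _z ∈ hfin.toFinset, ((d : ℕ∞) + 1) :=
          Finset.sum_le_sum fun z _ => (Set.encard_insert_le _ _).trans (add_le_add (hd z) le_rfl)
      _ ≤ ((d + 1) ^ (r + 1) : ℕ) := by
          rw [Finset.sum_const, nsmul_eq_mul, pow_succ]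
          push_cast
          push_cast at hcard
          exact mul_le_mul_left hcard _

end Clusters

/-! ### From Følner sets to local hyperfiniteness -/

/-- Cutting off Følner sets one after another splits a finite set into small pieces. -/
lemma exists_removal_of_folner {ε : ℝ} {k : ℕ}
    (h : ∀ L : Set V, L.Finite → L.Nonempty → ∃ M : Set V, IsFolnerIn G ε L M ∧ M.ncard ≤ k) :
    ∀ (n : ℕ) (L : Set V), L.Finite → L.ncard ≤ n →
      ∃ L' : Set V, L' ⊆ L ∧ (L'.ncard : ℝ) ≤ ε * (L.ncard : ℝ) ∧ ComponentsLE G (L \ L') k := by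
  intro n
  induction n with
  | zero =>
    intro L hL hn
    have : L = ∅ := (Set.ncard_eq_zero hL).1 (Nat.le_zero.1 hn)
    subst this
    exact ⟨∅, le_rfl, by simp, componentsLE_of_encard_le (by simp)⟩
  | succ n ih =>
    intro L hL hn
    rcases L.eq_empty_or_nonempty with rfl | hne
    · exact ⟨∅, le_rfl, by simp, componentsLE_of_encard_le (by simp)⟩
    obtain ⟨M, ⟨hML, hMfin, hMne, hMε⟩, hMk⟩ := h L hL hne
    have hMpos : 0 < M.ncard := (Set.ncard_pos hMfin).2 hMne
    have hsplit : (L \ M).ncard + M.ncard = L.ncard := Set.ncard_sdiff_add_ncard_of_subset hML hL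
    obtain ⟨L₁, hL₁, hL₁ε, hL₁k⟩ := ih (L \ M) (hL.subset Set.sdiff_subset) (by omega)
    have hbM : relBoundary G L M ⊆ M := fun x hx => hx.1
    refine ⟨relBoundary G L M ∪ L₁, Set.union_subset (hbM.trans hML) (hL₁.trans Set.sdiff_subset),
      ?_, ?_⟩
    · have h1 : ((relBoundary G L M ∪ L₁).ncard : ℝ) ≤ (relBoundary G L M).ncard + L₁.ncard := by
        exact_mod_cast Set.ncard_union_le _ _
      have h2 : ((relBoundary G L M).ncard : ℝ) ≤ ε * M.ncard := by
        rw [div_lt_iff₀ (by exact_mod_cast hMpos)] at hMε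
        exact hMε.le
      have h3 : (L.ncard : ℝ) = (L \ M).ncard + M.ncard := by exact_mod_cast hsplit.symm
      rw [h3, mul_add]
      linarith
    · refine componentsLE_of_fibres (fun v => v ∈ M) ?_ ?_
      -- An edge of `L` leaving `M` has its end in `M` in the relative boundary, which has been
      -- removed.
      · intro a b ha hb hab
        by_contra hne
        have key : ∀ a b, a ∈ L \ (relBoundary G L M ∪ L₁) → b ∈ L → G.Adj a b → a ∈ M → b ∈ M := by
          intro a b ha hb hab haM
          by_contra hbM
          exact ha.2 (Or.inl ⟨haM, b, hb, hbM, hab⟩)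
        exact hne (propext ⟨key a b ha hb.1 hab, key b a hb ha.1 hab.symm⟩)
      · intro x hx
        by_cases hxM : x ∈ M
        · refine componentsLE_of_encard_le ?_
          calc _ ≤ M.encard := Set.encard_le_encard fun v hv => by
                have := hv.2
                simpa [hxM] using this
            _ ≤ k := by
                rw [← hMfin.cast_ncard_eq]
                exact_mod_cast hMk
        · refine hL₁k.mono fun v hv => ?_
          have hvM : v ∉ M := by
            have := hv.2
            simpa [hxM] using this
          exact ⟨⟨hv.1.1, hvM⟩, fun hvL => hv.1.2 (Or.inr hvL)⟩

lemma UniformlyLocallyAmenable.locallyHyperfinite (h : UniformlyLocallyAmenable G) :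
    LocallyHyperfinite G := by
  intro ε hε
  -- Halving `ε` turns the non-strict bound of the greedy removal into a strict one.
  obtain ⟨k, hk, hF⟩ := h (ε / 2) (by positivity)
  refine ⟨k, hk, fun L hL hne => ?_⟩
  obtain ⟨L', h1, h2, h3⟩ := exists_removal_of_folner hF _ L hL le_rfl
  have hpos : (0 : ℝ) < L.ncard := by exact_mod_cast (Set.ncard_pos hL).2 hne
  exact ⟨L', h1, h2.trans_lt (by nlinarith), h3⟩

/-! ### The coarea inequality and Følner sets from property A -/

/-- The layer-cake formula on `[0, 1]` for a finite sum. -/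
lemma integral_sum_indicator_Ico {ι : Type*} (s : Finset ι) (a b : ι → ℝ) :
    Integrable (fun t : ℝ => ∑ i ∈ s, (Set.Ico (a i) (b i)).indicator (fun _ => (1 : ℝ)) t) ∧
    ∫ t : ℝ, ∑ i ∈ s, (Set.Ico (a i) (b i)).indicator (fun _ => (1 : ℝ)) t
      = ∑ i ∈ s, max (b i - a i) 0 := by
  have hint : ∀ i, Integrable ((Set.Ico (a i) (b i)).indicator (fun _ => (1 : ℝ))) := fun i =>
    (integrable_indicator_iff measurableSet_Ico).2 (integrableOn_const (by simp))
  refine ⟨integrable_finsetSum _ fun i _ => hint i, ?_⟩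
  rw [integral_finsetSum _ fun i _ => hint i]
  refine Finset.sum_congr rfl fun i _ => ?_
  rw [integral_indicator measurableSet_Ico]
  simp [Measure.real, ENNReal.toReal_ofReal']

lemma HasDegreeBound.card_filter_adj_le [DecidableRel G.Adj] {d : ℕ} (hd : HasDegreeBound G d)
    (L : Finset V) (x : V) : (L.filter (G.Adj x)).card ≤ d := by
  have h : ((L.filter (G.Adj x) : Finset V) : Set V) ⊆ G.neighborSet x := by
    intro y hy
    simpa using (Finset.mem_filter.1 hy).2
  have := (Set.encard_le_encard h).trans (hd x)
  rw [Set.encard_coe_eq_coe_finsetCard] at this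
  exact_mod_cast this

/-- The coarea inequality: if every level set of `f` on `L` has large boundary, then the total
variation of `f` along the edges in `L` is large. -/
lemma sum_le_variation_of_level_sets [DecidableEq V] [DecidableRel G.Adj] (L : Finset V) (f : V → ℝ)
    (hf : ∀ x, 0 ≤ f x) {ε : ℝ}
    (h : ∀ t : ℝ, 0 ≤ t → ε * ((L.filter (fun x => t < f x)).card : ℝ) ≤
      (((L ×ˢ L).filter (fun q => G.Adj q.1 q.2 ∧ t < f q.1 ∧ f q.2 ≤ t)).card : ℝ)) :
    ε * ∑ x ∈ L, f x ≤
      ∑ q ∈ (L ×ˢ L).filter (fun q => G.Adj q.1 q.2), max (f q.1 - f q.2) 0 := by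
  obtain ⟨hi1, he1⟩ := integral_sum_indicator_Ico L (fun _ => 0) f
  obtain ⟨hi2, he2⟩ := integral_sum_indicator_Ico
    ((L ×ˢ L).filter (fun q => G.Adj q.1 q.2)) (fun q => f q.2) (fun q => f q.1)
  have hsum : ∑ x ∈ L, f x = ∑ x ∈ L, max (f x - 0) 0 :=
    Finset.sum_congr rfl fun x _ => by rw [sub_zero, max_eq_left (hf x)]
  rw [hsum, ← he1, ← he2, ← integral_const_mul]
  refine integral_mono (hi1.const_mul ε) hi2 fun t => ?_
  rcases lt_or_ge t 0 with ht | ht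
  · have h0 : ∑ x ∈ L, (Set.Ico 0 (f x)).indicator (fun _ => (1 : ℝ)) t = 0 :=
      Finset.sum_eq_zero fun x _ => Set.indicator_of_notMem (fun h => absurd h.1 (not_le.2 ht)) _
    simp only [h0, mul_zero]
    exact Finset.sum_nonneg fun q _ => Set.indicator_nonneg (fun _ _ => zero_le_one) _
  -- At height `t ≥ 0` the left integrand counts the level set, and the right one the oriented edges
  -- that descend across `t`.
  · have := h t ht
    simp only [Set.indicator_apply, Set.mem_Ico, ht, true_and, Finset.sum_boole, Finset.filter_filter]
    simpa [and_comm, and_left_comm] using this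

lemma PropertyA.uniformlyLocallyAmenable {d : ℕ} (hd : HasDegreeBound G d) (h : PropertyA G) :
    UniformlyLocallyAmenable G := by
  classical
  intro ε hε
  -- There are at most `d|L|` oriented edges in `L`, and `d / (d + 1) < 1` gives the final
  -- contradiction.
  obtain ⟨r, -, Θ, hprob, hsupp, hvar⟩ := h (ε / (d + 1)) (by positivity)
  refine ⟨(d + 1) ^ r, by positivity, fun L hL hne => ?_⟩
  by_contra! hcon
  lift L to Finset V using hL
  have hball : ∀ v, (ball G v r).Finite := fun v =>
    Set.finite_of_encard_le_coe (ball_encard_le hd v r)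
  -- `W` contains the supports of all `Θ x` with `x ∈ L`, so all sums over `v` become finite.
  let W : Finset V := L.biUnion fun x => (hball x).toFinset
  have hW : ∀ x ∈ L, ∀ v ∉ W, Θ x v = 0 := by
    intro x hx v hv
    by_contra hne
    exact hv (Finset.mem_biUnion.2 ⟨x, hx, (hball x).mem_toFinset.2 (hsupp x hne)⟩)
  have hlevel : ∀ v : V, ∀ t : ℝ, 0 ≤ t → ε * ((L.filter (fun x => t < Θ x v)).card : ℝ) ≤
      (((L ×ˢ L).filter (fun q => G.Adj q.1 q.2 ∧ t < Θ q.1 v ∧ Θ q.2 v ≤ t)).card : ℝ) := by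
    intro v t ht
    set M := L.filter (fun x => t < Θ x v) with hM
    rcases M.eq_empty_or_nonempty with hMe | hMne
    · simp [hMe]
    have hMball : (M : Set V) ⊆ ball G v r := by
      intro x hx
      have hx' := (Finset.mem_filter.1 (Finset.mem_coe.1 hx)).2
      exact mem_ball_comm.1 (hsupp x (ht.trans_lt hx').ne')
    have hMk : (M : Set V).ncard ≤ (d + 1) ^ r := by
      have := (Set.encard_le_encard hMball).trans (ball_encard_le hd v r)
      rw [← M.finite_toSet.cast_ncard_eq] at this
      exact_mod_cast this
    have hnot : ¬ IsFolnerIn G ε L M := fun hF => absurd hMk (not_le.2 (hcon M hF))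
    have hMpos : (0 : ℝ) < (M : Set V).ncard := by
      exact_mod_cast (Set.ncard_pos M.finite_toSet).2 (Finset.coe_nonempty.2 hMne)
    have hbd : ε * ((M : Set V).ncard : ℝ) ≤ (relBoundary G (L : Set V) (M : Set V)).ncard := by
      by_contra! hlt
      refine hnot ⟨Finset.coe_subset.2 (Finset.filter_subset _ _), M.finite_toSet, Finset.coe_nonempty.2 hMne, ?_⟩
      rwa [div_lt_iff₀ hMpos]
    rw [Set.ncard_coe_finset] at hbd
    refine hbd.trans ?_
    -- Each boundary vertex is the upper end of an edge crossing the level `t`, so there are at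
    -- least as many such edges.
    have hsub : relBoundary G (L : Set V) (M : Set V) ⊆
        (((L ×ˢ L).filter (fun q => G.Adj q.1 q.2 ∧ t < Θ q.1 v ∧ Θ q.2 v ≤ t)).image Prod.fst :
          Finset V) := by
      rintro x ⟨hxM, y, hyL, hyM, hxy⟩
      have hx' := Finset.mem_filter.1 (Finset.mem_coe.1 hxM)
      have hy' : Θ y v ≤ t := by
        by_contra! hlt
        exact hyM (Finset.mem_coe.2 (Finset.mem_filter.2 ⟨hyL, hlt⟩))
      refine Finset.mem_coe.2 (Finset.mem_image.2 ⟨(x, y), Finset.mem_filter.2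
        ⟨Finset.mem_product.2 ⟨hx'.1, hyL⟩, hxy, hx'.2, hy'⟩, rfl⟩)
    have h1 := Set.ncard_le_ncard hsub (Finset.finite_toSet _)
    rw [Set.ncard_coe_finset] at h1
    exact_mod_cast h1.trans Finset.card_image_le
  set E := (L ×ˢ L).filter (fun q => G.Adj q.1 q.2) with hE
  have hstep : ∀ v, ε * ∑ x ∈ L, Θ x v ≤ ∑ q ∈ E, |Θ q.1 v - Θ q.2 v| := fun v =>
    (sum_le_variation_of_level_sets L (fun x => Θ x v) (fun x => (hprob x).1 v) (hlevel v)).trans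
      (Finset.sum_le_sum fun q _ => max_le (le_abs_self _) (abs_nonneg _))
  have htot := Finset.sum_le_sum fun v (_ : v ∈ W) => hstep v
  rw [← Finset.mul_sum, Finset.sum_comm, Finset.sum_comm (s := W)] at htot
  have hone : ∀ x ∈ L, ∑ v ∈ W, Θ x v = 1 := fun x hx =>
    (hasSum_sum_of_ne_finset_zero (hW x hx)).unique (hprob x).2
  have hlt : ∀ q ∈ E, ∑ v ∈ W, |Θ q.1 v - Θ q.2 v| ≤ ε / (d + 1) := by
    intro q hq
    obtain ⟨hq1, hq2⟩ := Finset.mem_filter.1 hq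
    obtain ⟨hqa, hqb⟩ := Finset.mem_product.1 hq1
    have hoff : ∀ v ∉ W, |Θ q.1 v - Θ q.2 v| = 0 := fun v hv => by
      rw [hW _ hqa v hv, hW _ hqb v hv, sub_zero, abs_zero]
    rw [← tsum_eq_sum (L := SummationFilter.unconditional V) hoff]
    exact (hvar _ _ hq2).le
  have hEcard : E.card ≤ L.card * d := by
    rw [hE, Finset.card_filter, Finset.sum_product, ← smul_eq_mul, ← Finset.sum_const]
    refine Finset.sum_le_sum fun x _ => ?_
    rw [← Finset.card_filter]
    exact hd.card_filter_adj_le L x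
  rw [Finset.sum_congr rfl hone] at htot
  have hup := htot.trans (Finset.sum_le_sum hlt)
  simp only [Finset.sum_const, nsmul_eq_mul, mul_one] at hup
  have hLpos : (0 : ℝ) < L.card := by
    exact_mod_cast Finset.card_pos.2 (Finset.coe_nonempty.1 hne)
  have hEc : (E.card : ℝ) ≤ L.card * d := by exact_mod_cast hEcard
  have : (E.card : ℝ) * (ε / (d + 1)) < ε * L.card := by
    calc (E.card : ℝ) * (ε / (d + 1)) ≤ L.card * d * (ε / (d + 1)) := by gcongr
      _ = ε * L.card * (d / (d + 1)) := by ring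
      _ < ε * L.card * 1 := by
          gcongr
          rw [div_lt_one (by positivity)]
          linarith
      _ = ε * L.card := mul_one _
  linarith

/-! ### From local to weighted hyperfiniteness -/

/-- The vertices of `S` with a much heavier neighbour in `S` carry little weight. -/
lemma weight_of_unbalanced_le [DecidableRel G.Adj] {d : ℕ} (hd : HasDegreeBound G d)
    (S : Finset V) {w : V → ℝ} (hw : ∀ v, 0 ≤ w v) {B : ℝ} (hB : 0 < B)
    {D : Finset V} (hD : ∀ v ∈ D, ∃ u ∈ S, G.Adj u v ∧ B * w v < w u) :
    ∑ v ∈ D, w v ≤ d / B * ∑ u ∈ S, w u := by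
  -- Each `v` is charged to a neighbour `u` with `w v ≤ w u / B`; each `u` is charged at most `d`
  -- times.
  calc ∑ v ∈ D, w v ≤ ∑ v ∈ D, ∑ u ∈ S, (if G.Adj u v then w u / B else 0) := by
        refine Finset.sum_le_sum fun v hv => ?_
        obtain ⟨u, hu, huv, hlt⟩ := hD v hv
        have h1 : w v ≤ if G.Adj u v then w u / B else 0 := by
          rw [if_pos huv, le_div_iff₀ hB, mul_comm]
          exact hlt.le
        refine h1.trans (Finset.single_le_sum
          (f := fun u => if G.Adj u v then w u / B else 0) (fun u' _ => ?_) hu)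
        split_ifs
        exacts [div_nonneg (hw _) hB.le, le_rfl]
    _ = ∑ u ∈ S, ∑ v ∈ D, (if G.Adj u v then w u / B else 0) := Finset.sum_comm
    _ = ∑ u ∈ S, ((D.filter (G.Adj u)).card : ℝ) * (w u / B) := by
        refine Finset.sum_congr rfl fun u _ => ?_
        rw [← Finset.sum_filter, Finset.sum_const, nsmul_eq_mul]
    _ ≤ ∑ u ∈ S, (d : ℝ) * (w u / B) := by
        refine Finset.sum_le_sum fun u _ => mul_le_mul_of_nonneg_right ?_ (div_nonneg (hw _) hB.le)
        exact_mod_cast hd.card_filter_adj_le D u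
    _ = d / B * ∑ u ∈ S, w u := by
        rw [Finset.mul_sum]
        exact Finset.sum_congr rfl fun u _ => by ring

/-- Some residue class of the integer labelling `l` carries at most the average weight. -/
lemma exists_light_residue (S : Finset V) (w : V → ℝ) (l : V → ℤ) {K : ℕ} (hK : 0 < K) :
    ∃ j : ℤ, ∑ v ∈ S.filter (fun v => (l v - j) % K = 0), w v ≤ (∑ v ∈ S, w v) / K := by
  have hfib : ∑ j ∈ Finset.Ico (0 : ℤ) K, ∑ v ∈ S.filter (fun v => l v % K = j), w v
      = ∑ v ∈ S, w v :=
    Finset.sum_fiberwise_of_maps_to (fun v _ => Finset.mem_Ico.2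
      ⟨Int.emod_nonneg _ (by omega), Int.emod_lt_of_pos _ (by exact_mod_cast hK)⟩) _
  have hconst : ∑ _j ∈ Finset.Ico (0 : ℤ) K, (∑ v ∈ S, w v) / K = ∑ v ∈ S, w v := by
    rw [Finset.sum_const, nsmul_eq_mul]
    simp only [Int.card_Ico, sub_zero, Int.toNat_natCast]
    field_simp
  obtain ⟨j, hj, hle⟩ := Finset.exists_le_of_sum_le
    (⟨0, Finset.mem_Ico.2 ⟨le_rfl, by exact_mod_cast hK⟩⟩ : (Finset.Ico (0 : ℤ) K).Nonempty)
    (hfib.trans hconst.symm).le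
  refine ⟨j, ?_⟩
  have hiff : ∀ v, (l v - j) % K = 0 ↔ l v % K = j := by
    intro v
    obtain ⟨h0, h1⟩ := Finset.mem_Ico.1 hj
    rw [← Int.emod_eq_emod_iff_emod_sub_eq_zero, Int.emod_eq_of_lt h0 h1]
  simpa only [hiff] using hle

/-- Adjacent integers outside the multiples of `K` have the same quotient by `K`. -/
lemma ediv_eq_ediv_of_abs_sub_le_one {a b K : ℤ} (hK : 0 < K) (h1 : a ≤ b + 1) (h2 : b ≤ a + 1)
    (ha : a % K ≠ 0) (hb : b % K ≠ 0) : a / K = b / K := by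
  have key : ∀ a b : ℤ, a ≤ b + 1 → a % K ≠ 0 → a / K ≤ b / K := by
    intro a b h ha
    rw [Int.le_ediv_iff_mul_le hK]
    have h3 := Int.mul_ediv_add_emod a K
    have h4 := Int.emod_nonneg a hK.ne'
    have h5 : 0 < a % K := lt_of_le_of_ne h4 ha.symm
    rw [mul_comm]
    omega
  exact le_antisymm (key a b h1 ha) (key b a h2 hb)

/-- If the weights on each fibre of `q` in `T` differ at most by the factor `R`, removals that are
small in number on each fibre are small in weight. -/
lemma weight_of_fibrewise_removal_le [DecidableEq V] (T : Finset V) {w : V → ℝ}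
    (hw : ∀ v, 0 ≤ w v) (q : V → ℤ) {δ R : ℝ} (hδ : 0 ≤ δ) (c : ℤ → ℝ) (hc : ∀ i, 0 ≤ c i)
    (hlow : ∀ v ∈ T, c (q v) ≤ w v) (hhigh : ∀ v ∈ T, w v ≤ R * c (q v)) (hR : 0 ≤ R)
    (N : ℤ → Finset V) (hN : ∀ i, N i ⊆ T.filter (fun v => q v = i))
    (hcard : ∀ i, ((N i).card : ℝ) ≤ δ * (T.filter (fun v => q v = i)).card) :
    ∑ v ∈ T.filter (fun v => v ∈ N (q v)), w v ≤ δ * R * ∑ v ∈ T, w v := by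
  have hmaps : ∀ v ∈ T, q v ∈ T.image q := fun v hv => Finset.mem_image_of_mem q hv
  rw [← Finset.sum_fiberwise_of_maps_to hmaps,
    ← Finset.sum_fiberwise_of_maps_to (s := T.filter _)
      (fun v hv => hmaps v (Finset.mem_filter.1 hv).1), Finset.mul_sum]
  refine Finset.sum_le_sum fun i _ => ?_
  have hsub : (T.filter (fun v => v ∈ N (q v))).filter (fun v => q v = i) ⊆ N i := by
    intro v hv
    obtain ⟨hv1, rfl⟩ := Finset.mem_filter.1 hv
    exact (Finset.mem_filter.1 hv1).2
  calc _ ≤ ∑ v ∈ N i, w v := Finset.sum_le_sum_of_subset_of_nonneg hsub fun v _ _ => hw v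
    _ ≤ ∑ _v ∈ N i, R * c i := Finset.sum_le_sum fun v hv => by
        obtain ⟨hvT, rfl⟩ := Finset.mem_filter.1 (hN i hv)
        exact hhigh v hvT
    _ = (N i).card * (R * c i) := by rw [Finset.sum_const, nsmul_eq_mul]
    _ ≤ (δ * (T.filter (fun v => q v = i)).card) * (R * c i) :=
        mul_le_mul_of_nonneg_right (hcard i) (mul_nonneg hR (hc i))
    _ = δ * R * ∑ _v ∈ T.filter (fun v => q v = i), c i := by
        rw [Finset.sum_const, nsmul_eq_mul]; ring
    _ ≤ δ * R * ∑ v ∈ T.filter (fun v => q v = i), w v := by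
        refine mul_le_mul_of_nonneg_left (Finset.sum_le_sum fun v hv => ?_) (mul_nonneg hδ hR)
        obtain ⟨hvT, rfl⟩ := Finset.mem_filter.1 hv
        exact hlow v hvT

lemma LocallyHyperfinite.weightedHyperfinite {d : ℕ} (hd : HasDegreeBound G d)
    (h : LocallyHyperfinite G) : WeightedHyperfinite G := by
  classical
  intro ε hε
  -- The allowance `ε` is split into thirds: `B` bounds the weight of `D₁`, `K` that of `D₂` and `δ`
  -- that of `D₃`. The summand 2 keeps `B > 1`.
  set B : ℝ := 2 + 3 * d / ε with hBdef
  have hB1 : 1 < B := by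
    have : 0 ≤ 3 * d / ε := by positivity
    linarith
  have hB0 : 0 < B := by linarith
  have hdB : d / B ≤ ε / 3 := by
    rw [div_le_iff₀ hB0, hBdef]
    have : ε / 3 * (2 + 3 * d / ε) = 2 * ε / 3 + d := by field_simp
    rw [this]
    linarith
  obtain ⟨K, hKε⟩ := exists_nat_gt (3 / ε)
  have hK0' : (0 : ℝ) < K := lt_trans (by positivity) hKε
  have hK0 : 0 < K := by exact_mod_cast hK0'
  have hKinv : 1 / (K : ℝ) ≤ ε / 3 := by
    rw [div_lt_iff₀ hε] at hKε
    rw [div_le_iff₀ hK0']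
    linarith
  -- Weights within a band differ by a factor of at most `B ^ K`, which `δ` absorbs.
  set δ : ℝ := ε / (3 * B ^ K) with hδ
  have hδ0 : 0 < δ := by positivity
  obtain ⟨k, hk, hlh⟩ := h δ hδ0
  refine ⟨k, hk, fun w hw hfin => ?_⟩
  set S : Finset V := hfin.toFinset with hS
  have hSpos : ∀ v ∈ S, 0 < w v := fun v hv =>
    lt_of_le_of_ne (hw v) (Ne.symm (hfin.mem_toFinset.1 hv))
  let l : V → ℤ := fun v => ⌊Real.logb B (w v)⌋
  obtain ⟨j, hj⟩ := exists_light_residue S w l hK0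
  let D₁ := S.filter fun v => ∃ u ∈ S, G.Adj u v ∧ B * w v < w u
  let D₂ := S.filter fun v => (l v - j) % K = 0
  let T := S \ (D₁ ∪ D₂)
  -- The band index. On `T`, levels of adjacent vertices differ by at most 1 and avoid the residue
  -- `j`, so no edge joins two bands.
  let q : V → ℤ := fun v => (l v - j) / K
  have hremove : ∀ i : ℤ, ∃ N : Finset V, N ⊆ T.filter (fun v => q v = i) ∧
      (N.card : ℝ) ≤ δ * (T.filter (fun v => q v = i)).card ∧
      ComponentsLE G ((T.filter (fun v => q v = i) : Set V) \ N) k := by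
    intro i
    rcases (T.filter (fun v => q v = i)).eq_empty_or_nonempty with he | hne
    · exact ⟨∅, by simp, by simp [he], componentsLE_of_encard_le (by simp [he])⟩
    · obtain ⟨N, hN1, hN2, hN3⟩ := hlh _ (Finset.finite_toSet _) (Finset.coe_nonempty.2 hne)
      lift N to Finset V using (Finset.finite_toSet _).subset hN1
      rw [Set.ncard_coe_finset, Set.ncard_coe_finset] at hN2
      exact ⟨N, Finset.coe_subset.1 hN1, hN2.le, hN3⟩
  choose N hN1 hN2 hN3 using hremove
  let D₃ := T.filter fun v => v ∈ N (q v)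
  have hTS : T ⊆ S := Finset.sdiff_subset
  have hl : ∀ v ∈ S, B ^ l v ≤ w v ∧ w v < B ^ (l v + 1) := by
    intro v hv
    have h0 := hSpos v hv
    constructor
    · have := Int.floor_le (Real.logb B (w v))
      rw [Real.le_logb_iff_rpow_le hB1 h0, Real.rpow_intCast] at this
      exact this
    · have := Int.lt_floor_add_one (Real.logb B (w v))
      rw [Real.logb_lt_iff_lt_rpow hB1 h0] at this
      rw [← Real.rpow_intCast]
      push_cast
      exact this
  have hladj : ∀ u ∈ T, ∀ v ∈ T, G.Adj u v → l u ≤ l v + 1 := by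
    intro u hu v hv huv
    have hle : w u ≤ B * w v := by
      by_contra! hlt
      have hvD : v ∈ D₁ := Finset.mem_filter.2 ⟨hTS hv, u, hTS hu, huv, hlt⟩
      exact (Finset.mem_sdiff.1 hv).2 (Finset.mem_union_left _ hvD)
    have h2 : B ^ l u < B ^ (l v + 2) := by
      calc B ^ l u ≤ w u := (hl u (hTS hu)).1
        _ ≤ B * w v := hle
        _ < B * B ^ (l v + 1) := mul_lt_mul_of_pos_left (hl v (hTS hv)).2 hB0
        _ = B ^ (l v + 2) := by
            rw [← zpow_one_add₀ hB0.ne']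
            congr 1
            ring
    have := (zpow_lt_zpow_iff_right₀ hB1).1 h2
    omega
  have hlmod : ∀ v ∈ T, (l v - j) % K ≠ 0 := fun v hv h0 =>
    (Finset.mem_sdiff.1 hv).2 (Finset.mem_union_right _ (Finset.mem_filter.2 ⟨hTS hv, h0⟩))
  have hqadj : ∀ u ∈ T, ∀ v ∈ T, G.Adj u v → q u = q v := by
    intro u hu v hv huv
    have h1 := hladj u hu v hv huv
    have h2 := hladj v hv u hu huv.symm
    exact ediv_eq_ediv_of_abs_sub_le_one (by exact_mod_cast hK0) (by omega) (by omega)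
      (hlmod u hu) (hlmod v hv)
  have hW1 : ∑ v ∈ D₁, w v ≤ ε / 3 * ∑ v ∈ S, w v :=
    (weight_of_unbalanced_le hd S hw hB0
      (fun v hv => (Finset.mem_filter.1 hv).2)).trans
      (mul_le_mul_of_nonneg_right hdB (Finset.sum_nonneg fun v _ => hw v))
  have hW2 : ∑ v ∈ D₂, w v ≤ ε / 3 * ∑ v ∈ S, w v := by
    refine hj.trans ?_
    rw [div_eq_mul_one_div, mul_comm]
    exact mul_le_mul_of_nonneg_right hKinv (Finset.sum_nonneg fun v _ => hw v)
  have hW3 : ∑ v ∈ D₃, w v ≤ ε / 3 * ∑ v ∈ S, w v := by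
    have hquot : ∀ v, q v * K ≤ l v - j ∧ l v - j + 1 ≤ q v * K + K := by
      intro v
      have h1 := Int.mul_ediv_add_emod (l v - j) K
      have h2 := Int.emod_nonneg (l v - j) (by omega : (K : ℤ) ≠ 0)
      have h3 := Int.emod_lt_of_pos (l v - j) (by exact_mod_cast hK0 : (0 : ℤ) < K)
      have h4 : q v * K = K * ((l v - j) / K) := mul_comm _ _
      constructor <;> omega
    have hkey := weight_of_fibrewise_removal_le T hw q hδ0.le (fun i => B ^ (i * K + j))
      (fun i => (zpow_pos hB0 _).le)
      (fun v hv => (zpow_le_zpow_right₀ hB1.le (by have := (hquot v).1; omega)).trans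
        (hl v (hTS hv)).1)
      (R := B ^ K) (fun v hv => by
        refine (hl v (hTS hv)).2.le.trans ?_
        rw [← zpow_natCast, ← zpow_add₀ hB0.ne']
        exact zpow_le_zpow_right₀ hB1.le (by have := (hquot v).2; omega))
      (by positivity) N hN1 hN2
    have hδB : δ * B ^ K = ε / 3 := by
      rw [hδ]; field_simp
    rw [hδB] at hkey
    exact hkey.trans (mul_le_mul_of_nonneg_left
      (Finset.sum_le_sum_of_subset_of_nonneg hTS fun v _ _ => hw v) (by positivity))
  -- Vertices outside the support weigh nothing, so all of them may be deleted.
  refine ⟨{v | v ∉ S} ∪ ((D₁ ∪ D₂ ∪ D₃ : Finset V) : Set V), ?_, ?_⟩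
  · have hsum : ∑ᶠ v, w v = ∑ v ∈ S, w v := finsum_eq_sum_of_support_toFinset_subset w hfin le_rfl
    have hDS : D₁ ∪ D₂ ∪ D₃ ⊆ S := Finset.union_subset (Finset.union_subset
      (Finset.filter_subset _ _) (Finset.filter_subset _ _))
      ((Finset.filter_subset _ _).trans hTS)
    have hsumL : ∑ᶠ v ∈ {v | v ∉ S} ∪ ((D₁ ∪ D₂ ∪ D₃ : Finset V) : Set V), w v
        = ∑ v ∈ D₁ ∪ D₂ ∪ D₃, w v := by
      rw [← finsum_mem_coe_finset]
      refine finsum_mem_inter_support_eq' _ _ _ fun v hv => ?_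
      have hvS : v ∈ S := hfin.mem_toFinset.2 hv
      simp [hvS]
    rw [hsum, hsumL]
    have hun : ∀ A C : Finset V, ∑ v ∈ A ∪ C, w v ≤ ∑ v ∈ A, w v + ∑ v ∈ C, w v := by
      intro A C
      rw [← Finset.sum_union_inter]
      linarith [Finset.sum_nonneg fun v (_ : v ∈ A ∩ C) => hw v]
    have h1 := hun (D₁ ∪ D₂) D₃
    have h2 := hun D₁ D₂
    linarith
  · have hmem : ∀ v, v ∈ ({v | v ∉ S} ∪ ((D₁ ∪ D₂ ∪ D₃ : Finset V) : Set V))ᶜ ↔ v ∈ T ∧ v ∉ N (q v) := by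
      intro v
      simp only [Set.mem_compl_iff, Set.mem_union, Set.mem_ofPred_eq, Finset.mem_coe,
        Finset.mem_union, D₃, T, Finset.mem_filter, Finset.mem_sdiff]
      tauto
    refine componentsLE_of_fibres q
      (fun a b ha hb hab => hqadj a ((hmem a).1 ha).1 b ((hmem b).1 hb).1 hab) fun x hx => ?_
    refine (hN3 (q x)).mono fun v hv => ?_
    obtain ⟨hvT, hvN⟩ := (hmem v).1 hv.1
    have hq : q v = q x := hv.2
    exact ⟨Finset.mem_coe.2 (Finset.mem_filter.2 ⟨hvT, hq⟩), fun h => hvN (hq ▸ h)⟩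

/-! ### Minimax on a compact space -/

/-- A minimax theorem: if every finite nonnegative combination of the continuous functions `g i`
takes a nonpositive value, all the `g i` have nonpositive mean for one probability measure. -/
lemma exists_isProbabilityMeasure_integral_nonpos {X ι : Type*} [TopologicalSpace X]
    [CompactSpace X] [T2Space X] [MeasurableSpace X] [BorelSpace X] (g : ι → C(X, ℝ))
    (h : ∀ w : ι →₀ ℝ, (∀ i, 0 ≤ w i) → ∃ x, w.sum (fun i a => a * g i x) ≤ 0) :
    ∃ μ : Measure X, IsProbabilityMeasure μ ∧ ∀ i, ∫ x, g i x ∂μ ≤ 0 := by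
  obtain ⟨x₀, -⟩ := h 0 (by simp)
  have : Nonempty X := ⟨x₀⟩
  -- The cone generated by the nonnegative functions and the `-g i`. A functional nonnegative on it
  -- is positive and has value at most 0 on every `g i`; the hypothesis makes `c • 1 ↦ c`
  -- nonnegative on the constants in it.
  let s : PointedCone ℝ C(X, ℝ) :=
    { carrier := {f | ∃ w : ι →₀ ℝ, (∀ i, 0 ≤ w i) ∧
        ∀ x, 0 ≤ f x + w.sum (fun i a => a * g i x)}
      zero_mem' := ⟨0, by simp, by simp⟩
      add_mem' := by
        rintro f f' ⟨w, hw, hf⟩ ⟨w', hw', hf'⟩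
        refine ⟨w + w', fun i => add_nonneg (hw i) (hw' i), fun x => ?_⟩
        rw [Finsupp.sum_add_index' (by simp) (fun _ _ _ => add_mul _ _ _), ContinuousMap.add_apply]
        linarith [hf x, hf' x]
      smul_mem' := by
        rintro ⟨c, hc⟩ f ⟨w, hw, hf⟩
        refine ⟨c • w, fun i => mul_nonneg hc (hw i), fun x => ?_⟩
        rw [Finsupp.sum_smul_index (by simp)]
        have h1 := mul_nonneg hc (hf x)
        have h2 : (w.sum fun i a => c * a * g i x) = c * w.sum fun i a => a * g i x := by
          rw [Finsupp.mul_sum]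
          simp only [mul_assoc]
        rw [h2]
        calc (0 : ℝ) ≤ _ := h1
          _ = _ := mul_add _ _ _ }
  have hmem : ∀ f : C(X, ℝ), f ∈ s ↔ ∃ w : ι →₀ ℝ, (∀ i, 0 ≤ w i) ∧
        ∀ x, 0 ≤ f x + w.sum (fun i a => a * g i x) := fun _ => Iff.rfl
  have hone : (1 : C(X, ℝ)) ≠ 0 := one_ne_zero
  let φ : C(X, ℝ) →ₗ.[ℝ] ℝ := LinearPMap.mkSpanSingleton (1 : C(X, ℝ)) (1 : ℝ) hone
  have hφ : ∀ (c : ℝ) (hc : c • (1 : C(X, ℝ)) ∈ φ.domain), φ ⟨c • (1 : C(X, ℝ)), hc⟩ = c := by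
    intro c hc
    refine (LinearPMap.mkSpanSingleton'_apply _ _ _ _ _).trans ?_
    simp
  obtain ⟨Λ, hΛ1, hΛs⟩ := riesz_extension s φ
    (by
      rintro ⟨f, hf⟩ hfs
      obtain ⟨c, rfl⟩ := Submodule.mem_span_singleton.1 hf
      rw [hφ]
      obtain ⟨w, hw, hwx⟩ := (hmem _).1 hfs
      obtain ⟨x, hx⟩ := h w hw
      have := hwx x
      simp only [ContinuousMap.smul_apply, ContinuousMap.one_apply, smul_eq_mul, mul_one] at this
      linarith)
    -- The constants are cofinal for the cone, since `‖f‖ + f ≥ 0`.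
    (by
      intro f
      refine ⟨⟨‖f‖ • (1 : C(X, ℝ)), Submodule.smul_mem _ _ (Submodule.mem_span_singleton_self _)⟩,
        (hmem _).2 ⟨0, by simp, fun x => ?_⟩⟩
      have := (abs_le.1 (f.norm_coe_le_norm x)).1
      simp only [ContinuousMap.add_apply, ContinuousMap.smul_apply, ContinuousMap.one_apply,
        smul_eq_mul, mul_one, Finsupp.sum_zero_index, add_zero]
      linarith)
  have hΛpos : ∀ f : C(X, ℝ), (∀ x, 0 ≤ f x) → 0 ≤ Λ f := fun f hf =>
    hΛs f ((hmem _).2 ⟨0, by simp, by simpa using hf⟩)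
  have hΛone : Λ 1 = 1 := by
    have h1 : (1 : ℝ) • (1 : C(X, ℝ)) ∈ φ.domain :=
      Submodule.smul_mem _ _ (Submodule.mem_span_singleton_self _)
    have h2 := (hΛ1 ⟨_, h1⟩).trans (hφ 1 h1)
    simpa only [one_smul] using h2
  have hΛg : ∀ i, Λ (g i) ≤ 0 := by
    intro i
    have h1 := hΛs (-g i) ((hmem _).2 ⟨Finsupp.single i 1, fun j => by
      classical
      rw [Finsupp.single_apply]; split_ifs <;> simp, fun x => by simp⟩)
    rw [map_neg] at h1
    linarith
  -- On a compact space every continuous function has compact support, so Riesz–Markov represents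
  -- `Λ` by a measure.
  let Ψ : CompactlySupportedContinuousMap X ℝ →ₚ[ℝ] ℝ :=
    PositiveLinearMap.mk₀
      { toFun := fun f => Λ f.toContinuousMap
        map_add' := fun f f' => Λ.map_add f.toContinuousMap f'.toContinuousMap
        map_smul' := fun c f => Λ.map_smul c f.toContinuousMap }
      (fun f hf => hΛpos _ fun x => hf x)
  have hint : ∀ f : C(X, ℝ), ∫ x, f x ∂(RealRMK.rieszMeasure Ψ) = Λ f := fun f =>
    RealRMK.integral_rieszMeasure Ψ (CompactlySupportedContinuousMap.continuousMapEquiv f)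
  refine ⟨RealRMK.rieszMeasure Ψ, ⟨?_⟩, fun i => (hint _).trans_le (hΛg i)⟩
  have h1 := hint 1
  rw [hΛone] at h1
  simp only [ContinuousMap.one_apply, integral_const, smul_eq_mul, mul_one] at h1
  exact (ENNReal.toReal_eq_one_iff _).1 h1

/-! ### The compact space of separators and the random separator -/

/-- Whether `y` is joined to `x` off `Y` by a path is an open condition on `Y`. -/
lemma isOpen_setOf_mem_cluster (G : SimpleGraph V) (x y : V) :
    IsOpen {Y : V → Bool | y ∈ cluster G {v | Y v = true}ᶜ x} := by
  have heq : {Y : V → Bool | y ∈ cluster G {v | Y v = true}ᶜ x} =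
      ⋃ F : {F : Finset V // y ∈ cluster G (F : Set V) x}, ⋂ v ∈ F.1, {Y : V → Bool | Y v = false} := by
    ext Y
    simp only [Set.mem_iUnion, Set.mem_iInter, Set.mem_ofPred_eq]
    constructor
    · intro h
      obtain ⟨F, hF, hy⟩ := exists_finset_mem_cluster h
      exact ⟨⟨F, hy⟩, fun v hv => by simpa using hF hv⟩
    · rintro ⟨⟨F, hF⟩, h⟩
      exact cluster_mono (fun v hv => by simpa using h v hv) hF
  rw [heq]
  refine isOpen_iUnion fun F => isOpen_biInter_finset fun v _ => ?_
  exact (isOpen_discrete ({false} : Set Bool)).preimage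
    (continuous_apply v : Continuous fun Y : V → Bool => Y v)

/-- Failure is witnessed by finitely many vertices: more than `k` of them in one cluster, each an
open condition. -/
lemma isClosed_separators (G : SimpleGraph V) {k : ℕ} (hk : 0 < k) : IsClosed (Separators G k) := by
  have heq : (Separators G k)ᶜ = ⋃ x : V, ⋃ F : {F : Finset V // k < F.card},
      ⋂ y ∈ F.1, {Y : V → Bool | y ∈ cluster G {v | Y v = true}ᶜ x} := by
    ext Y
    simp only [Set.mem_compl_iff, Set.mem_iUnion, Set.mem_iInter, Set.mem_ofPred_eq]
    constructor
    · intro h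
      by_contra hcon
      refine h (componentsLE_iff.2 fun x _ => ?_)
      by_contra! hlt
      obtain ⟨T, hT, hTk⟩ := Set.exists_subset_encard_eq (Order.add_one_le_of_lt hlt)
      have hTk' : T.encard = ((k + 1 : ℕ) : ℕ∞) := by rw [hTk]; push_cast; rfl
      lift T to Finset V using Set.finite_of_encard_eq_coe hTk'
      rw [Set.encard_coe_eq_coe_finsetCard] at hTk'
      have hTk'' : T.card = k + 1 := by exact_mod_cast hTk'
      exact hcon ⟨x, ⟨T, by omega⟩, fun y hy => hT (Finset.mem_coe.2 hy)⟩
    · rintro ⟨x, ⟨F, hF⟩, hy⟩ hY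
      have h1 : (F : Set V).encard ≤ k :=
        (Set.encard_le_encard fun y hyF => hy y hyF).trans
          (ComponentsLE.cluster_encard_le (k := k) hY hk x)
      rw [Set.encard_coe_eq_coe_finsetCard] at h1
      have : F.card ≤ k := by exact_mod_cast h1
      omega
  rw [← isOpen_compl_iff, heq]
  exact isOpen_iUnion fun x => isOpen_iUnion fun F => isOpen_biInter_finset fun y _ =>
    isOpen_setOf_mem_cluster G x y

/-- The indicator of the clopen event that the random separator contains `x`. -/
noncomputable def membership (G : SimpleGraph V) (k : ℕ) (x : V) : C(Separators G k, ℝ) where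
  toFun Y := if Y.1 x = true then 1 else 0
  continuous_toFun := (continuous_of_discreteTopology
    (f := fun b : Bool => if b = true then (1 : ℝ) else 0)).comp ((continuous_apply x).comp continuous_subtype_val)

lemma measurableSet_setOf_mem {k : ℕ} (x : V) :
    MeasurableSet {Y : Separators G k | Y.1 x = true} := by
  have h : Measurable fun Y : Separators G k => Y.1 x :=
    (measurable_pi_apply x).comp measurable_subtype_coe
  exact h (measurableSet_singleton true)

lemma WeightedHyperfinite.stronglyHyperfinite [Countable V] (h : WeightedHyperfinite G) :
    StronglyHyperfinite G := by
  classical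
  intro ε hε
  obtain ⟨k, hk, hw⟩ := h (ε / 2) (by positivity)
  have : CompactSpace (Separators G k) :=
    isCompact_iff_compactSpace.1 (isClosed_separators G hk).isCompact
  -- For the functions `1_{x ∈ Y} - ε / 2`, the minimax hypothesis is weighted hyperfiniteness for
  -- `ε / 2`.
  obtain ⟨μ, hμ, hle⟩ := exists_isProbabilityMeasure_integral_nonpos
    (fun x : V => membership G k x - ContinuousMap.const _ (ε / 2)) (by
      intro w hw0
      obtain ⟨L, hL, hsep⟩ := hw w hw0 w.hasFiniteSupport
      refine ⟨⟨fun v => decide (v ∈ L), by simpa [Separators] using hsep⟩, ?_⟩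
      have h1 : ∑ᶠ v, w v = ∑ v ∈ w.support, w v :=
        finsum_eq_sum_of_support_subset _ (by simp)
      have h2 : ∑ᶠ v ∈ L, w v = ∑ v ∈ w.support, if v ∈ L then w v else 0 := by
        rw [finsum_mem_def, finsum_eq_sum_of_support_subset (s := w.support)]
        · simp only [Set.indicator_apply]
        · intro v hv
          simp only [Function.mem_support, Set.indicator_apply] at hv
          simp only [Finset.mem_coe, Finsupp.mem_support_iff]
          exact fun h0 => hv (by simp [h0])
      rw [h1, h2, Finset.mul_sum, ← sub_nonpos, ← Finset.sum_sub_distrib] at hL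
      refine le_of_eq_of_le (Finset.sum_congr rfl fun v _ => ?_) hL
      simp only [membership, ContinuousMap.sub_apply, ContinuousMap.coe_mk, decide_eq_true_eq,
        ContinuousMap.const_apply]
      split_ifs <;> ring)
  refine ⟨k, hk, μ, hμ, fun x => ?_⟩
  have hint : ∫ Y, (membership G k x - ContinuousMap.const (Separators G k) (ε / 2)) Y ∂μ
      = μ.real {Y : Separators G k | Y.1 x = true} - ε / 2 := by
    have heq : (fun Y => (membership G k x - ContinuousMap.const (Separators G k) (ε / 2)) Y) = fun Y =>
        {Y : Separators G k | Y.1 x = true}.indicator (fun _ => (1 : ℝ)) Y - ε / 2 := by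
      ext Y
      simp [membership, Set.indicator_apply]
    rw [heq, integral_sub ((integrable_const _).indicator (measurableSet_setOf_mem x))
      (integrable_const _), integral_indicator (measurableSet_setOf_mem x)]
    simp
  have := hle x
  rw [hint] at this
  rw [← ENNReal.ofReal_toReal (measure_ne_top μ _)]
  refine (ENNReal.ofReal_lt_ofReal_iff hε).2 ?_
  change μ.real _ < ε
  linarith

/-! ### From a random separator to property A -/

/-- The uniform distribution on the cluster of `x` in `S`. -/
noncomputable def clusterMass (G : SimpleGraph V) (S : Set V) (x : V) : V → ℝ :=
  (cluster G S x).indicator fun _ => ((cluster G S x).ncard : ℝ)⁻¹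

lemma clusterMass_nonneg (S : Set V) (x v : V) : 0 ≤ clusterMass G S x v :=
  Set.indicator_nonneg (fun _ _ => by positivity) _

lemma clusterMass_le_one (S : Set V) (x v : V) : clusterMass G S x v ≤ 1 :=
  Set.indicator_le' (fun _ _ => Nat.cast_inv_le_one _) (fun _ _ => zero_le_one) v

lemma ncard_cluster_eq_sum {S : Set V} {x : V} {F : Finset V} (h : cluster G S x ⊆ F) :
    ((cluster G S x).ncard : ℝ) = ∑ v ∈ F, (cluster G S x).indicator (fun _ => (1 : ℝ)) v := by
  classical
  have heq : cluster G S x = (F.filter (· ∈ cluster G S x) : Finset V) := by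
    ext v
    simp only [Finset.coe_filter, Set.mem_ofPred_eq]
    exact ⟨fun hv => ⟨Finset.mem_coe.1 (h hv), hv⟩, fun hv => hv.2⟩
  simp only [Set.indicator_apply, Finset.sum_boole]
  conv_lhs => rw [heq, Set.ncard_coe_finset]

lemma sum_clusterMass {S : Set V} {x : V} {F : Finset V} (h : cluster G S x ⊆ F) :
    ∑ v ∈ F, clusterMass G S x v = 1 := by
  have hpos : ((cluster G S x).ncard : ℝ) ≠ 0 := by
    have := (Set.ncard_pos (F.finite_toSet.subset h)).2 ⟨x, mem_cluster_self G S x⟩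
    positivity
  have hm : ∀ v, clusterMass G S x v =
      ((cluster G S x).ncard : ℝ)⁻¹ * (cluster G S x).indicator (fun _ => (1 : ℝ)) v := by
    intro v
    by_cases hv : v ∈ cluster G S x <;> simp [clusterMass, hv]
  simp only [hm]
  rw [← Finset.mul_sum, ← ncard_cluster_eq_sum h, inv_mul_cancel₀ hpos]

/-- If both ends lie in `S` the clusters coincide; otherwise the right side is at least 2, the
largest ℓ¹ distance between probability measures. -/
lemma sum_abs_clusterMass_sub_le {S : Set V} {x y : V} (hxy : G.Adj x y) {F : Finset V}
    (hx : cluster G S x ⊆ F) (hy : cluster G S y ⊆ F) :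
    ∑ v ∈ F, |clusterMass G S x v - clusterMass G S y v| ≤
      2 * (Sᶜ.indicator (fun _ => (1 : ℝ)) x + Sᶜ.indicator (fun _ => (1 : ℝ)) y) := by
  have htwo : ∑ v ∈ F, |clusterMass G S x v - clusterMass G S y v| ≤ 2 := by
    calc _ ≤ ∑ v ∈ F, (clusterMass G S x v + clusterMass G S y v) := by
          refine Finset.sum_le_sum fun v _ => (abs_sub _ _).trans ?_
          rw [abs_of_nonneg (clusterMass_nonneg S x v), abs_of_nonneg (clusterMass_nonneg S y v)]
      _ = 2 := by rw [Finset.sum_add_distrib, sum_clusterMass hx, sum_clusterMass hy]; norm_num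
  by_cases hxS : x ∈ S <;> by_cases hyS : y ∈ S
  · have : clusterMass G S x = clusterMass G S y := by
      rw [clusterMass, clusterMass, cluster_eq_of_adj hxS hyS hxy]
    simp [this, hxS, hyS]
  · simpa [hxS, hyS] using htwo
  · simpa [hxS, hyS] using htwo
  · refine htwo.trans ?_
    simp [hxS, hyS]

lemma StronglyHyperfinite.propertyA [Countable V] {d : ℕ} (hd : HasDegreeBound G d)
    (h : StronglyHyperfinite G) : PropertyA G := by
  classical
  intro ε hε
  obtain ⟨k, hk, μ, hμ, hlt⟩ := h (ε / 4) (by positivity)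
  have hball : ∀ v, (ball G v k).Finite := fun v =>
    Set.finite_of_encard_le_coe (ball_encard_le hd v k)
  let c : Separators G k → V → Set V := fun Y x => cluster G {v | Y.1 v = true}ᶜ x
  let m : Separators G k → V → V → ℝ := fun Y x v => clusterMass G {v | Y.1 v = true}ᶜ x v
  have hcball : ∀ Y x, c Y x ⊆ ball G x k := fun Y x v hv =>
    edist_le_of_mem_cluster (ComponentsLE.cluster_encard_le (k := k) Y.2 hk x) hv
  have hcfin : ∀ Y x, c Y x ⊆ ((hball x).toFinset : Finset V) := fun Y x => by
    simpa using hcball Y x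
  have hind : ∀ x v, Measurable fun Y : Separators G k => (c Y x).indicator (fun _ => (1 : ℝ)) v := by
    intro x v
    have hopen : IsOpen {Y : Separators G k | v ∈ c Y x} :=
      (isOpen_setOf_mem_cluster G x v).preimage continuous_subtype_val
    exact (measurable_const (a := (1 : ℝ))).indicator hopen.measurableSet
  have hmeas : ∀ x v, Measurable fun Y => m Y x v := by
    intro x v
    -- Inside the fixed finite ball the cluster size is a finite sum of measurable indicators.
    have heq : (fun Y => m Y x v) = fun Y => (c Y x).indicator (fun _ => (1 : ℝ)) v *
        (∑ u ∈ (hball x).toFinset, (c Y x).indicator (fun _ => (1 : ℝ)) u)⁻¹ := by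
      ext Y
      rw [← ncard_cluster_eq_sum (hcfin Y x)]
      by_cases hv : v ∈ c Y x
      · simp [m, clusterMass, hv, c]
      · simp [m, clusterMass, hv, Set.indicator_of_notMem (show v ∉ cluster G _ x from hv)]
    rw [heq]
    exact (hind x v).mul (Finset.measurable_sum _ fun u _ => hind x u).inv
  have hint : ∀ x v, Integrable (fun Y => m Y x v) μ := fun x v =>
    Integrable.of_bound (hmeas x v).aestronglyMeasurable 1 (Filter.Eventually.of_forall fun Y => by
      rw [Real.norm_of_nonneg (clusterMass_nonneg _ x v)]
      exact clusterMass_le_one _ x v)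
  let Θ : V → V → ℝ := fun x v => ∫ Y, m Y x v ∂μ
  have hzero : ∀ x, ∀ v ∉ ball G x k, Θ x v = 0 := fun x v hv => by
    have hm0 : ∀ Y, m Y x v = 0 := fun Y =>
      Set.indicator_of_notMem (fun hvc => hv (hcball Y x hvc)) _
    simp [Θ, hm0]
  -- Radius `k` would suffice for the supports; `k + 1` meets the requirement `1 < r`.
  refine ⟨k + 1, by omega, Θ, fun x => ⟨fun v => ?_, ?_⟩, fun x v hv => ?_, fun x y hxy => ?_⟩
  · exact integral_nonneg fun Y => clusterMass_nonneg _ x v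
  · have hsum : ∑ v ∈ (hball x).toFinset, Θ x v = 1 := by
      rw [← integral_finsetSum _ fun v _ => hint x v]
      have : (fun Y => ∑ v ∈ (hball x).toFinset, m Y x v) = fun _ => 1 := by
        ext Y
        exact sum_clusterMass (hcfin Y x)
      simp [this]
    rw [← hsum]
    exact hasSum_sum_of_ne_finset_zero fun v hv => hzero x v (by simpa using hv)
  · have hvk : v ∈ ball G x k := by
      by_contra hcon
      exact hv (hzero x v hcon)
    exact le_trans (show G.edist x v ≤ k from hvk) (by exact_mod_cast Nat.le_succ k)
  · let F := (hball x).toFinset ∪ (hball y).toFinset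
    have hxF : ∀ Y, c Y x ⊆ F := fun Y v hv => by
      simp only [F, Finset.coe_union, Set.mem_union]; exact Or.inl (hcfin Y x hv)
    have hyF : ∀ Y, c Y y ⊆ F := fun Y v hv => by
      simp only [F, Finset.coe_union, Set.mem_union]; exact Or.inr (hcfin Y y hv)
    have hoff : ∀ v ∉ F, |Θ x v - Θ y v| = 0 := fun v hv => by
      simp only [F, Finset.mem_union, Set.Finite.mem_toFinset, not_or] at hv
      rw [hzero x v hv.1, hzero y v hv.2, sub_zero, abs_zero]
    rw [tsum_eq_sum (L := SummationFilter.unconditional V) hoff]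
    let A : V → Set (Separators G k) := fun x => {Y | Y.1 x = true}
    have hA : ∀ x, Integrable ((A x).indicator fun _ => (1 : ℝ)) μ := fun x =>
      (integrable_const _).indicator (measurableSet_setOf_mem x)
    have hAint : ∀ x, ∫ Y, (A x).indicator (fun _ => (1 : ℝ)) Y ∂μ < ε / 4 := fun x => by
      rw [integral_indicator (measurableSet_setOf_mem x)]
      simp only [integral_const, smul_eq_mul, mul_one, MeasurableSet.univ, measureReal_restrict_apply,
        Set.univ_inter]
      exact (ENNReal.lt_ofReal_iff_toReal_lt (measure_ne_top μ _)).1 (hlt x)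
    calc ∑ v ∈ F, |Θ x v - Θ y v| ≤ ∑ v ∈ F, ∫ Y, |m Y x v - m Y y v| ∂μ := by
          refine Finset.sum_le_sum fun v _ => ?_
          rw [← integral_sub (hint x v) (hint y v)]
          exact abs_integral_le_integral_abs
      _ = ∫ Y, ∑ v ∈ F, |m Y x v - m Y y v| ∂μ :=
          (integral_finsetSum _ fun v _ => ((hint x v).sub (hint y v)).abs).symm
      _ ≤ ∫ Y, 2 * ((A x).indicator (fun _ => (1 : ℝ)) Y + (A y).indicator (fun _ => (1 : ℝ)) Y) ∂μ := by
          refine integral_mono (integrable_finsetSum _ fun v _ => ((hint x v).sub (hint y v)).abs)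
            (((hA x).add (hA y)).const_mul 2) fun Y => ?_
          refine (sum_abs_clusterMass_sub_le hxy (hxF Y) (hyF Y)).trans (le_of_eq ?_)
          simp [A, Set.indicator_apply]
      _ = 2 * (∫ Y, (A x).indicator (fun _ => (1 : ℝ)) Y ∂μ
            + ∫ Y, (A y).indicator (fun _ => (1 : ℝ)) Y ∂μ) := by
          rw [integral_const_mul, integral_add (hA x) (hA y)]
      _ < ε := by linarith [hAint x, hAint y]

end BoundedDegreeGraph

theorem theorem1 {V : Type*} [Countable V] (d : ℕ) (G : SimpleGraph V)
    (hd : BoundedDegreeGraph.HasDegreeBound G d) :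
    [BoundedDegreeGraph.PropertyA G,
      BoundedDegreeGraph.UniformlyLocallyAmenable G,
      BoundedDegreeGraph.LocallyHyperfinite G,
      BoundedDegreeGraph.WeightedHyperfinite G,
      BoundedDegreeGraph.StronglyHyperfinite G].TFAE := by
  tfae_have 1 → 2 := fun h => h.uniformlyLocallyAmenable hd
  tfae_have 2 → 3 := fun h => h.locallyHyperfinite
  tfae_have 3 → 4 := fun h => h.weightedHyperfinite hd
  tfae_have 4 → 5 := fun h => h.stronglyHyperfinite
  tfae_have 5 → 1 := fun h => h.propertyA hd
  tfae_finish
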